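/- **Conventions.** Algebras have nonempty universes. A class of similar algebras is a *quasivariety* if it is closed under isomorphisms, subalgebras, direct products and ultraproducts. Let $\mathsf{K}$ be a quasivariety with language $\mathscr{L}_{\mathsf{K}}$. An *$n$-ary operation* of $\mathsf{K}$ is a family $f=\langle f^{\mathbf A}:\mathbf A\in\mathsf K\rangle$ of partial functions $f^{\mathbf A}$ from $A^n$ to $A$ such that, for every homomorphism $h\colon\mathbf A\to\mathbf B$ between members of $\mathsf K$ and every $\bar a\in\mathrm{dom}(f^{\mathbf A})$, we have $h(\bar a)\in\mathrm{dom}(f^{\mathbf B})$ and $h(f^{\mathbf A}(\bar a))=f^{\mathbf B}(h(\bar a))$. A formula $\psi(x_1,\dots,x_n,y)$ of $\mathscr L_{\mathsf K}$ *defines* $f$ if for all $\mathbf A\in\mathsf K$, $\bar a\in A^n$ and $b\in A$ we have $\mathbf A\vDash\psi(\bar a,b)$ if and only if $\bar a\in\mathrm{dom}(f^{\mathbf A})$ and $f^{\mathbf A}(\bar a)=b$. An operation of arity $n\ge 1$ is *implicit* if it is defined by a first order formula, and *pp definable* if it is defined by a pp formula, i.e. a formula $\exists z_1,\dots,z_m\,\varphi$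 with $\varphi$ a finite conjunction of equations. An implicit operation $f$ is *extendable* if for all $\mathbf A\in\mathsf K$ and $\bar a\in\mathrm{dom}(f^{\mathbf A})$ there is an extension $\mathbf B\in\mathsf K$ of $\mathbf A$ with $\bar a\in\mathrm{dom}(f^{\mathbf B})$. It *has unique witnesses* if it can be defined by a pp formula $\exists z_1,\dots,z_m\,\varphi(\bar z,\bar x,y)$ (with $\varphi$ a finite conjunction of equations) such that for all $\mathbf A\in\mathsf K$ and $\bar a\in\mathrm{dom}(f^{\mathbf A})$ there is exactly one $\bar b\in A^m$ with $\mathbf A\vDash\varphi(\bar b,\bar a,f^{\mathbf A}(\bar a))$. Let $\mathsf{ext}_{pp}(\mathsf K)$ be the class of extendable pp definable implicit operations of $\mathsf K$, and $\mathsf{ext}_{pp!}(\mathsf K)$ its subclass of those with unique witnesses. For $\mathcal F\subseteq\mathsf{ext}_{pp}(\mathsf K)$ let $\mathscr L_{\mathcal F}$ be $\mathscr L_{\mathsf K}$ together with a new $n$-ary function symbol $g_f$ for each $n$-ary $f\in\mathcal F$. Let $\mathsf K[\mathscr L_{\mathcal F}]$ be the class of the algebras $\mathbf A[\mathscr L_{\mathcal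 F}]$ obtained from those $\mathbf A\in\mathsf K$ on which every $f\in\mathcal F$ is total by interpreting each $g_f$ as $f^{\mathbf A}$. The class $\mathbb S(\mathsf K[\mathscr L_{\mathcal F}])$ of subalgebras of members of $\mathsf K[\mathscr L_{\mathcal F}]$ is the *pp expansion* of $\mathsf K$ induced by $\mathcal F$. A pp expansion is *simple* if it is of the form $\mathsf K[\mathscr L_{\mathcal G}]$ for some $\mathcal G\subseteq\mathsf{ext}_{pp}(\mathsf K)$. A pp expansion $\mathsf M$ of $\mathsf K$ is a *Beth companion* of $\mathsf K$ if, in the category of members of $\mathsf M$ and all homomorphisms between them, every monomorphism is regular; a Beth companion is *simple* if it is a simple pp expansion. **Theorem.** Every Beth companion of a quasivariety $\mathsf K$ that is induced by a subset of $\mathsf{ext}_{pp!}(\mathsf K)$ is simple. More precisely, if $\mathcal F\subseteq\mathsf{ext}_{pp!}(\mathsf K)$ and $\mathbb S(\mathsf K[\mathscr L_{\mathcal F}])$ is a Beth companion of $\mathsf K$, then $\mathbb S(\mathsf K[\mathscr L_{\mathcal F}])=\mathsf K[\mathscr L_{\mathcal F}]$, and hence $\mathbb S(\mathsf K[\mathscr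 L_{\mathcal F}])$ is a simple Beth companion of $\mathsf K$. -/

import Mathlib

open FirstOrder FirstOrder.Language CategoryTheory

universe u w

noncomputable section

namespace Beth

/-! ### Algebras and quasivarieties

An algebraic language is a first-order language without relation symbols
(`Language.IsAlgebraic`). As usual in universal algebra, algebras have nonempty universes. -/

/-- A (nonempty) algebra in the language `L`. -/
structure Alg (L : FirstOrder.Language.{u, 0}) where
  carrier : Type w
  [str : L.Structure carrier]
  [nonempty : Nonempty carrier]

attribute [instance] Alg.str Alg.nonempty

instance (L : FirstOrder.Language.{u, 0}) : CoeSort (Alg.{u, w} L) (Type w) := ⟨Alg.carrier⟩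

/-- The category of `L`-algebras and their homomorphisms. -/
instance (L : FirstOrder.Language.{u, 0}) : Category (Alg.{u, w} L) where
  Hom A B := A →[L] B
  id A := Hom.id L A
  comp f g := g.comp f
  id_comp _ := by ext; rfl
  comp_id _ := by ext; rfl
  assoc _ _ _ := by ext; rfl

/-- A class of algebras in the language `L`, also viewed as a full subcategory of the category
of all `L`-algebras. -/
abbrev AlgClass (L : FirstOrder.Language.{u, 0}) := ObjectProperty (Alg.{u, w} L)

variable {L : FirstOrder.Language.{u, 0}}

/-- Closure of a class of algebras under subalgebras (and isomorphic copies). -/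
def subalgebras (C : AlgClass.{u, w} L) : AlgClass.{u, w} L :=
  fun A => ∃ B : Alg.{u, w} L, C B ∧ Nonempty (A ↪[L] B)

/-- The direct product of a family of algebras, with componentwise operations. -/
def product {I : Type w} (A : I → Alg.{u, w} L) : Alg.{u, w} L where
  carrier := ∀ i, A i
  str :=
    { funMap := fun g x i => Structure.funMap g fun j => x j i
      RelMap := fun r x => ∀ i, Structure.RelMap r fun j => x j i }

/-- The ultraproduct of a family of algebras. -/
def ultraproduct {I : Type w} (U : Ultrafilter I) (A : I → Alg.{u, w} L) : Alg.{u, w} L where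
  carrier := (U : Filter I).Product fun i => (A i : Type w)
  str := Ultraproduct.structure

/-- A quasivariety: a class of similar algebras closed under isomorphic copies, subalgebras,
arbitrary direct products (the empty one included) and ultraproducts. -/
structure IsQuasivariety (K : AlgClass.{u, w} L) : Prop where
  iso_mem : ∀ A B : Alg.{u, w} L, K A → Nonempty (A ≃[L] B) → K B
  sub_mem : ∀ A : Alg.{u, w} L, K A → ∀ S : L.Substructure A, ∀ _ : Nonempty S, K ⟨S⟩
  product_mem : ∀ (I : Type w) (A : I → Alg.{u, w} L), (∀ i, K (A i)) → K (product A)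
  ultraproduct_mem : ∀ (I : Type w) (U : Ultrafilter I) (A : I → Alg.{u, w} L),
    (∀ i, K (A i)) → K (ultraproduct U A)

/-! ### Primitive positive formulas -/

/-- `φ` is a finite conjunction of equations. -/
def IsConjEq {α : Type} (φ : L.Formula α) : Prop :=
  ∃ (k : ℕ) (s t : Fin k → L.Term α), φ = Formula.iInf fun i => (s i).equal (t i)

/-- `ψ` is a primitive positive formula `∃ z₁ … zₘ φ`, with `φ` a finite conjunction of
equations. -/
def IsPP {α : Type} (ψ : L.Formula α) : Prop :=
  ∃ (m : ℕ) (φ : L.Formula (α ⊕ Fin m)), IsConjEq φ ∧ ψ = φ.iExs (Fin m)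

/-! ### Implicit operations -/

/-- An `n`-ary operation of a class `K`: a partial `n`-ary function on each member of `K`,
globally preserved by the homomorphisms between members of `K`. Here `b ∈ val A hA a` means that
`a` is in the domain and the value at `a` is `b`. -/
@[ext]
structure Operation (K : AlgClass.{u, w} L) (n : ℕ) where
  val : ∀ A : Alg.{u, w} L, K A → ((Fin n → A) →. A)
  preserved : ∀ (A B : Alg.{u, w} L) (hA : K A) (hB : K B) (h : A →[L] B)
    (a : Fin n → A) (b : A), b ∈ val A hA a → h b ∈ val B hB (h ∘ a)

/-- An operation of `K` of some arity. -/
abbrev Op (K : AlgClass.{u, w} L) := Σ n : ℕ, Operation K n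

variable {K : AlgClass.{u, w} L}

/-- `f` is defined in `K` by the formula `φ(x₁, …, xₙ, y)`; the variable `y` is
`Sum.inr ()`. -/
def Operation.DefinedBy {n : ℕ} (f : Operation K n) (φ : L.Formula (Fin n ⊕ Unit)) : Prop :=
  ∀ (A : Alg.{u, w} L) (hA : K A) (a : Fin n → A) (b : A),
    φ.Realize (Sum.elim a fun _ => b) ↔ b ∈ f.val A hA a

/-- `f` is extendable: whenever `a` is in the domain of `f` on `A ∈ K`, some extension of `A`
in `K` has `a` in the domain of `f`. -/
def Operation.Extendable {n : ℕ} (f : Operation K n) : Prop :=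
  ∀ (A : Alg.{u, w} L) (hA : K A) (a : Fin n → A), (f.val A hA a).Dom →
    ∃ (B : Alg.{u, w} L) (hB : K B) (e : A ↪[L] B), (f.val B hB (e ∘ a)).Dom

/-- `f` has unique witnesses: it is defined by a pp formula `∃ z₁ … zₘ φ(z, x, y)` such that for
every `A ∈ K` and every `a` in the domain of `f` there is exactly one tuple `z` of elements of
`A` with `φ(z, a, f(a))`. -/
def Operation.UniqueWitnesses {n : ℕ} (f : Operation K n) : Prop :=
  ∃ (m : ℕ) (φ : L.Formula ((Fin n ⊕ Unit) ⊕ Fin m)), IsConjEq φ ∧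
    f.DefinedBy (φ.iExs (Fin m)) ∧
    ∀ (A : Alg.{u, w} L) (hA : K A) (a : Fin n → A) (b : A), b ∈ f.val A hA a →
      ∃! z : Fin m → A, φ.Realize (Sum.elim (Sum.elim a fun _ => b) z)

variable (K)

/-- The implicit operations of `K`: those of positive arity defined by a first-order formula. -/
def imp : Set (Op K) := {f | 1 ≤ f.1 ∧ ∃ φ, f.2.DefinedBy φ}

/-- The implicit operations of `K` defined by a pp formula. -/
def impPP : Set (Op K) := {f | f ∈ imp K ∧ ∃ ψ, IsPP ψ ∧ f.2.DefinedBy ψ}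

/-- The extendable implicit operations of `K`. -/
def ext : Set (Op K) := {f | f ∈ imp K ∧ f.2.Extendable}

/-- The pp definable extendable implicit operations of `K`. -/
def extPP : Set (Op K) := ext K ∩ impPP K

/-- The pp definable implicit operations of `K` with unique witnesses. -/
def impPPUnique : Set (Op K) := {f | f ∈ impPP K ∧ f.2.UniqueWitnesses}

/-- The extendable pp definable implicit operations of `K` with unique witnesses. -/
def extPPUnique : Set (Op K) := extPP K ∩ impPPUnique K

variable {K}

/-! ### Adding implicit operations to a quasivariety -/

/-- The new function symbols: an `n`-ary symbol `g_f` for each `n`-ary `f ∈ F`. -/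
def newSymbols (F : Set (Op K)) : FirstOrder.Language.{max u (w + 1), 0} where
  Functions n := {f : Operation K n // (⟨n, f⟩ : Op K) ∈ F}
  Relations _ := Empty

/-- The language obtained from that of `K` by adding a symbol `g_f` for each `f ∈ F`. -/
abbrev langF (F : Set (Op K)) : FirstOrder.Language.{max u (w + 1), 0} := L.sum (newSymbols F)

/-- All members of `F` are total on `A ∈ K`. -/
def TotalOn (F : Set (Op K)) (A : Alg.{u, w} L) (hA : K A) : Prop :=
  ∀ f ∈ F, ∀ a : Fin f.1 → A, (f.2.val A hA a).Dom

/-- The expansion of `A ∈ K` that interprets each new symbol `g_f` as `f` on `A`, provided that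
all members of `F` are total on `A`. -/
def expand (F : Set (Op K)) (A : Alg.{u, w} L) (hA : K A) (hF : TotalOn F A hA) :
    Alg.{max u (w + 1), w} (langF F) where
  carrier := A
  str :=
    letI : (newSymbols F).Structure A :=
      { funMap := fun g a => (g.1.val A hA a).get (hF ⟨_, g.1⟩ g.2 a)
        RelMap := fun r _ => r.elim }
    FirstOrder.Language.sumStructure L (newSymbols F) A

/-- The class `K[L_F]` of all expansions of members of `K` on which all of `F` is total. -/
def expansions (F : Set (Op K)) : AlgClass.{max u (w + 1), w} (langF F) :=
  fun B => ∃ (A : Alg.{u, w} L) (hA : K A) (hF : TotalOn F A hA), B = expand F A hA hF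

set_option linter.checkUnivs false in
/-- A class of algebras together with its language. -/
abbrev ClassWithLang := Σ L' : FirstOrder.Language.{max u (w + 1), 0}, AlgClass.{max u (w + 1), w} L'

/-- The class `S(K[L_F])` induced by `F`, with its language. -/
def ppExpansion (F : Set (Op K)) : ClassWithLang.{u, w} := ⟨langF F, subalgebras (expansions F)⟩

variable (K)

/-- `M` is a pp expansion of `K`, that is, `M = S(K[L_F])` for a set `F` of extendable pp
definable implicit operations of `K`. -/
def IsPPExpansion (M : ClassWithLang.{u, w}) : Prop :=
  ∃ F : Set (Op K), F ⊆ extPP K ∧ M = ppExpansion F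

/-- `M` is a simple pp expansion of `K`: it is a pp expansion of the form `K[L_F]`. -/
def IsSimplePPExpansion (M : ClassWithLang.{u, w}) : Prop :=
  IsPPExpansion K M ∧ ∃ F : Set (Op K), F ⊆ extPP K ∧ M = ⟨langF F, expansions F⟩

/-- `M` is a Beth companion of `K`: a pp expansion of `K` in which, viewed as a category with all
homomorphisms as arrows, every monomorphism is regular. -/
def IsBethCompanion (M : ClassWithLang.{u, w}) : Prop :=
  IsPPExpansion K M ∧ IsRegularMonoCategory M.2.FullSubcategory

/-- A simple Beth companion: a Beth companion that is a simple pp expansion. -/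
def IsSimpleBethCompanion (M : ClassWithLang.{u, w}) : Prop :=
  IsBethCompanion K M ∧ IsSimplePPExpansion K M

end Beth

end

noncomputable section

namespace Beth

variable {L : FirstOrder.Language.{u, 0}}

/-! ### Conjunctions of equations -/

/-! Let `X` be a subalgebra of `Y` in `K[L_F]`, let `f ∈ F` and let `a` be a tuple in `X`. The
formula for `f` at `a` has witnesses `z` in `Y`, and the only question is whether they lie in `X`.
Let `C` be generated by `X` and `z`. Homomorphisms send witnesses to witnesses, so uniqueness makes
any two homomorphisms from `C` that agree on `X` agree on `z`: the inclusion of `X` in `C` is epi as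
well as mono. Regularity of monomorphisms makes the category balanced, so `X = C` contains `z`
(`exists_witnesses`). Then `f` is total on the reduct of `X` and `g_f` computes it. -/

theorem IsConjEq.realize_comp {α : Type} {φ : L.Formula α} (hφ : IsConjEq φ) {A B : Type*}
    [L.Structure A] [L.Structure B] (h : A →[L] B) {v : α → A} (hv : φ.Realize v) :
    φ.Realize (h ∘ v) := by
  obtain ⟨k, s, t, rfl⟩ := hφ
  rw [Formula.realize_iInf] at hv ⊢
  intro i
  have hi := hv i
  rw [Formula.realize_equal] at hi ⊢
  rw [HomClass.realize_term, HomClass.realize_term, hi]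

/-- Injectivity reflects equations. It does not reflect pp formulas, whose witnesses may lie outside
the subalgebra. -/
theorem IsConjEq.realize_of_comp {α : Type} {φ : L.Formula α} (hφ : IsConjEq φ) {A B : Type*}
    [L.Structure A] [L.Structure B] (e : A ↪[L] B) {v : α → A} (hv : φ.Realize (e ∘ v)) :
    φ.Realize v := by
  obtain ⟨k, s, t, rfl⟩ := hφ
  rw [Formula.realize_iInf] at hv ⊢
  intro i
  have hi := hv i
  rw [Formula.realize_equal] at hi ⊢
  rw [HomClass.realize_term, HomClass.realize_term] at hi
  exact e.injective hi

/-! ### Epimorphic embeddings in a balanced class -/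

/-- In a class of algebras whose category is balanced, an injective homomorphism that is
right-cancellable is surjective. -/
theorem surjective_of_injective_of_cancel {M : AlgClass.{u, w} L} [Balanced M.FullSubcategory]
    {A B : Alg.{u, w} L} (hA : M A) (hB : M B) (h : A →[L] B) (hinj : Function.Injective h)
    (hepi : ∀ (C : Alg.{u, w} L), M C → ∀ p q : B →[L] C, (∀ a, p (h a) = q (h a)) → p = q) :
    Function.Surjective h := by
  let X : M.FullSubcategory := ⟨A, hA⟩
  let Y : M.FullSubcategory := ⟨B, hB⟩
  let f : X ⟶ Y := ObjectProperty.homMk h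
  have : Mono f := ⟨fun {Z} p q hpq => by
    apply ObjectProperty.hom_ext
    refine Hom.ext (M := Z.obj) (N := A) fun z => hinj ?_
    exact DFunLike.congr_fun (F := Z.obj →[L] B) (congrArg (fun r => r.hom) hpq) z⟩
  have : Epi f := ⟨fun {Z} p q hpq => by
    apply ObjectProperty.hom_ext
    refine hepi Z.obj Z.property p.hom q.hom fun a => ?_
    exact DFunLike.congr_fun (F := A →[L] Z.obj) (congrArg (fun r => r.hom) hpq) a⟩
  have : IsIso f := isIso_of_mono_of_epi f
  intro b
  refine ⟨(show B →[L] A from (inv f).hom) b, ?_⟩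
  exact DFunLike.congr_fun (F := B →[L] B)
    (congrArg (fun r => r.hom) (IsIso.inv_hom_id f)) b

/-! ### Reducts -/

variable {K : AlgClass.{u, w} L} {F : Set (Op K)}

/-- The reduct of an algebra to the language of `K`. -/
def reduct (X : Alg.{max u (w + 1), w} (langF F)) : Alg.{u, w} L where
  carrier := X
  str := (LHom.sumInl : L →ᴸ langF F).reduct X

/-- A homomorphism, viewed as a homomorphism between the reducts. -/
def reductHom {X Y : Alg.{max u (w + 1), w} (langF F)} (h : X →[langF F] Y) :
    reduct X →[L] reduct Y where
  toFun := h
  map_fun' f x := h.map_fun' (Sum.inl f) x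
  map_rel' r x := h.map_rel' (Sum.inl r) x

/-- An embedding, viewed as an embedding between the reducts. -/
def reductEmbedding {X Y : Alg.{max u (w + 1), w} (langF F)} (e : X ↪[langF F] Y) :
    reduct X ↪[L] reduct Y where
  toFun := e
  inj' := e.injective
  map_fun' f x := e.map_fun' (Sum.inl f) x
  map_rel' r x := e.map_rel' (Sum.inl r) x

/-- The interpretation in `X` of the symbol added for `f`. -/
def newOp (X : Alg.{max u (w + 1), w} (langF F)) {n : ℕ} (f : Operation K n)
    (hf : (⟨n, f⟩ : Op K) ∈ F) (a : Fin n → X) : X :=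
  Structure.funMap (L := langF F) (Sum.inr ⟨f, hf⟩ : (langF F).Functions n) a

theorem map_newOp {X Y : Alg.{max u (w + 1), w} (langF F)} (h : X →[langF F] Y) {n : ℕ}
    (f : Operation K n) (hf : (⟨n, f⟩ : Op K) ∈ F) (a : Fin n → X) :
    h (newOp X f hf a) = newOp Y f hf (h ∘ a) :=
  h.map_fun' _ a

theorem newOp_expand_mem (A : Alg.{u, w} L) (hA : K A) (hT : TotalOn F A hA) {n : ℕ}
    (f : Operation K n) (hf : (⟨n, f⟩ : Op K) ∈ F) (a : Fin n → A) :
    newOp (expand F A hA hT) f hf a ∈ f.val A hA a :=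
  Part.get_mem _

theorem reduct_mem (hK : IsQuasivariety K) {X : Alg.{max u (w + 1), w} (langF F)}
    (hX : subalgebras (expansions F) X) : K (reduct X) := by
  obtain ⟨_, ⟨B, hB, hT, rfl⟩, ⟨e⟩⟩ := hX
  let e' : reduct X ↪[L] B := reductEmbedding e
  have hne : Nonempty e'.toHom.range :=
    ⟨⟨e' (Classical.arbitrary (reduct X)), e'.toHom.mem_range_self _⟩⟩
  exact hK.iso_mem _ _ (hK.sub_mem B hB e'.toHom.range hne) ⟨e'.equivRange.symm⟩

/-- An algebra is the expansion of its reduct as soon as each new symbol is interpreted by the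
corresponding operation. -/
theorem mem_expansions_of_newOp_mem (X : Alg.{max u (w + 1), w} (langF F)) (hX : K (reduct X))
    (h : ∀ (n : ℕ) (f : Operation K n) (hf : (⟨n, f⟩ : Op K) ∈ F) (a : Fin n → X),
      newOp X f hf a ∈ f.val (reduct X) hX a) : expansions F X := by
  have hT : TotalOn F (reduct X) hX := fun f hf a => Part.dom_iff_mem.2 ⟨_, h f.1 f.2 hf a⟩
  refine ⟨reduct X, hX, hT, ?_⟩
  -- Both algebras now visibly share the carrier `C`, so only their structures remain to be
  -- compared.
  obtain ⟨C, S, N⟩ := X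
  unfold expand
  congr 1
  refine Structure.ext ?_ ?_
  · funext n g a
    cases g with
    | inl g => rfl
    | inr g => exact (Part.get_eq_of_mem (h n g.1 g.2 a) _).symm
  · funext n r a
    cases r with
    | inl r => rfl
    | inr r => exact r.elim

theorem expansions_le_subalgebras : expansions F ≤ subalgebras (expansions F) :=
  fun A hA => ⟨A, hA, ⟨Embedding.refl _ A⟩⟩

/-! ### Beth companions induced by operations with unique witnesses -/

/-- If the category of `S(K[L_F])` is balanced, then its members contain all the unique witnesses
of the values of an operation in `F`. -/
theorem exists_witnesses [Balanced (ObjectProperty.FullSubcategory (subalgebras (expansions F)))]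
    {n : ℕ} {f : Operation K n} (hf : (⟨n, f⟩ : Op K) ∈ F) {m : ℕ}
    {φ : L.Formula ((Fin n ⊕ Unit) ⊕ Fin m)} (hφ : IsConjEq φ)
    (huniq : ∀ (A : Alg.{u, w} L) (hA : K A) (a : Fin n → A) (b : A), b ∈ f.val A hA a →
      ∃! z : Fin m → A, φ.Realize (Sum.elim (Sum.elim a fun _ => b) z))
    {X : Alg.{max u (w + 1), w} (langF F)} (hX : subalgebras (expansions F) X) (a : Fin n → X) :
    ∃ z : Fin m → reduct X,
      φ.Realize (M := reduct X) (Sum.elim (Sum.elim a fun _ => newOp X f hf a) z) := by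
  have hX' := hX
  obtain ⟨Y, hY, ⟨e⟩⟩ := hX
  obtain ⟨z, hz⟩ : ∃ z : Fin m → reduct Y, φ.Realize (M := reduct Y)
      (Sum.elim (Sum.elim (e ∘ a) fun _ => e (newOp X f hf a)) z) := by
    obtain ⟨B, hB, hT, rfl⟩ := hY
    refine (huniq B hB (e ∘ a) _ ?_).exists
    rw [show e (newOp X f hf a) = newOp _ f hf (e ∘ a) from map_newOp e.toHom f hf a]
    exact newOp_expand_mem B hB hT f hf _
  -- Closure is taken in the expanded language, so that `S` is again in `S(K[L_F])`.
  let S : (langF F).Substructure Y := Substructure.closure (langF F) (Set.range e ∪ Set.range z)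
  have heS : ∀ x, e x ∈ S := fun x => Substructure.subset_closure (Or.inl ⟨x, rfl⟩)
  have hzS : ∀ i, z i ∈ S := fun i => Substructure.subset_closure (Or.inr ⟨i, rfl⟩)
  have hne : Nonempty S := ⟨⟨_, heS (Classical.arbitrary X)⟩⟩
  let C : Alg.{max u (w + 1), w} (langF F) := ⟨S⟩
  have hC : subalgebras (expansions F) C := ⟨Y, hY, ⟨S.subtype⟩⟩
  let i : X ↪[langF F] C := e.codRestrict S heS
  let z' : Fin m → C := fun j => ⟨z j, hzS j⟩
  have hz' : φ.Realize (M := reduct C)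
      (Sum.elim (Sum.elim (i ∘ a) fun _ => i (newOp X f hf a)) z') := by
    refine hφ.realize_of_comp (reductEmbedding (X := C) (Y := Y) S.subtype) ?_
    convert hz using 1
    funext j
    obtain (_ | _) | _ := j <;> rfl
  have hsurj : Function.Surjective i.toHom := by
    refine surjective_of_injective_of_cancel hX' hC i.toHom i.injective fun D hD p q hpq => ?_
    -- Uniqueness is tested in `B`, where `g_f` is known to be `f`; in `D` this is not yet known.
    obtain ⟨_, ⟨B, hB, hT, rfl⟩, ⟨d⟩⟩ := hD
    have key : ∀ r : C →[langF F] D, φ.Realize (M := reduct (expand F B hB hT))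
        (Sum.elim (Sum.elim (fun j => d (r (i (a j)))) fun _ => d (r (i (newOp X f hf a))))
          fun j => d (r (z' j))) := fun r => by
      convert hφ.realize_comp (reductHom (d.toHom.comp r)) hz' using 1
      funext j
      obtain (_ | _) | _ := j <;> rfl
    have hpz : ∀ j, p (z' j) = q (z' j) := by
      have hval : d (p (i (newOp X f hf a))) ∈ f.val B hB (fun j => d (p (i (a j)))) := by
        rw [show d (p (i (newOp X f hf a))) = newOp _ f hf (fun j => d (p (i (a j)))) from
          map_newOp ((d.toHom.comp p).comp i.toHom) f hf a]
        exact newOp_expand_mem B hB hT f hf _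
      have hp := key p
      have hq := key q
      have hpq' : ∀ x, p (i x) = q (i x) := hpq
      -- The images of `z'` under `p` and `q` now witness the same instance of `φ`.
      simp only [← hpq'] at hq
      intro j
      exact d.injective (congrFun ((huniq B hB _ _ hval).unique hp hq) j)
    -- The set where `p` and `q` agree is closed under the operations and contains the generators.
    refine Hom.ext fun ⟨c, hc⟩ => ?_
    refine Substructure.closure_induction' (L := langF F) _
      (p := fun x hx => p ⟨x, hx⟩ = q ⟨x, hx⟩) ?_ ?_ hc
    · rintro x (⟨x, rfl⟩ | ⟨j, rfl⟩)
      · exact hpq x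
      · exact hpz j
    · intro k g x hx
      choose hxS hxe using hx
      refine ⟨S.fun_mem g x hxS, ?_⟩
      have hp := p.map_fun' g (fun j => ⟨x j, hxS j⟩)
      have hq := q.map_fun' g (fun j => ⟨x j, hxS j⟩)
      refine hp.trans (Eq.trans ?_ hq.symm)
      exact congrArg _ (funext hxe)
  choose y hy using fun j => hsurj (z' j)
  refine ⟨y, hφ.realize_of_comp (reductEmbedding i) ?_⟩
  convert hz' using 1
  funext j
  obtain (_ | _) | j := j
  · rfl
  · rfl
  · exact hy j

theorem subalgebras_expansions_eq (hK : IsQuasivariety K) (hF : F ⊆ extPPUnique K)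
    [Balanced (ObjectProperty.FullSubcategory (subalgebras (expansions F)))] :
    subalgebras (expansions F) = expansions F := by
  refine le_antisymm (fun X hX => ?_) expansions_le_subalgebras
  refine mem_expansions_of_newOp_mem X (reduct_mem hK hX) fun n f hf a => ?_
  obtain ⟨m, φ, hφ, hdef, huniq⟩ := (hF hf).2.2
  exact (hdef (reduct X) (reduct_mem hK hX) a _).1
    (Formula.realize_iExs.2 (exists_witnesses hf hφ huniq hX a))

end Beth

end

theorem mainTheorem3 {L : FirstOrder.Language.{u, 0}} [L.IsAlgebraic]
    (K : Beth.AlgClass.{u, w} L) (hK : Beth.IsQuasivariety K)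
    (F : Set (Beth.Op K)) (hF : F ⊆ Beth.extPPUnique K)
    (hBeth : Beth.IsBethCompanion K (Beth.ppExpansion F)) :
    Beth.subalgebras (Beth.expansions F) = Beth.expansions F ∧
      Beth.IsSimpleBethCompanion K (Beth.ppExpansion F) := by
  -- Regular monomorphisms are strong, whence the `Balanced` instance needed below.
  have : IsRegularMonoCategory
      (ObjectProperty.FullSubcategory (Beth.subalgebras (Beth.expansions F))) := hBeth.2
  have heq := Beth.subalgebras_expansions_eq hK hF
  refine ⟨heq, hBeth, hBeth.1, F, fun f hf => (hF hf).1, ?_⟩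
  rw [Beth.ppExpansion, heq]
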